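/- **Definitions.** All graphs are finite and simple. A graph is \emph{strongly regular} if it is regular, the number of common neighbours of two adjacent vertices is a constant $\lambda$, and the number of common neighbours of two distinct non-adjacent vertices is a constant $\mu$. A strongly regular graph with more than one vertex is \emph{primitive} if it and its complement are connected. The \emph{local graph} of $\Gamma$ at a vertex is the subgraph induced on its neighbours. For an integer $m\ge 1$, the \emph{$m$-clique extension} of a graph $\Delta$ with vertex set $W$ has vertex set $\{1,\dots,m\}\times W$, where $(i,\alpha)$ and $(j,\beta)$ are adjacent if and only if $\alpha,\beta$ are adjacent in $\Delta$, or $\alpha=\beta$ and $i\ne j$. For a graph $\Gamma$ with vertex set $\Omega$, let $A_0=I$, let $A_1$ and $A_2$ be the adjacency matrices of $\Gamma$ and of its complement, and for $\omega\in\Omega$ let $E^*_{0,\omega},E^*_{1,\omega},E^*_{2,\omega}$ be the diagonal $0/1$ matrices whose diagonals are the characteristic vectors of $\{\omega\}$, of the set of neighbours of $\omega$, and of the set of the other vertices. In the algebra of complex matrices indexed by $\Omega$, let $T_{0,\omega}$ be the linear span of the matrices $E^*_{i,\omega}A_jE^*_{k,\omega}$ ($0\le i,j,k\le 2$), let $T_\omega$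 be the subalgebra generated by all $A_j$ and $E^*_{i,\omega}$ (the Terwilliger algebra), and let $\tilde T_\omega$ be the algebra of all matrices that commute with the permutation matrices of the automorphisms of $\Gamma$ fixing $\omega$. The graph $\Gamma$ is \emph{triply transitive} if $\operatorname{Aut}(\Gamma)$ is transitive on $\Omega$ and $T_{0,\omega}=T_\omega=\tilde T_\omega$ for every $\omega\in\Omega$. A \emph{finite classical polar space} over $\mathbb F_q$ is the geometry of totally isotropic (respectively totally singular) subspaces of a finite-dimensional vector space over $\mathbb F_q$ with a nondegenerate alternating form, a nondegenerate Hermitian form (with respect to a field automorphism of order two), or a nonsingular quadratic form. Its \emph{rank} is the largest vector space dimension of such a subspace, its \emph{points} are the one-dimensional such subspaces, and in its \emph{collinearity graph} two distinct points are adjacent if and only if the two-dimensional subspace they span is totally isotropic (respectively totally singular). **Theorem.** Let $\mathcal P$ be a finite classical polar space of rank $n\ge 3$ over $\mathbb F_q$, with collinearity graph $\Gamma$. Then $\Gamma$ is a primitive strongly regular graph, and $\Gamma$ is not triply transitive. Moreover: 1. the local graph of $\Gamma$ at every point is isomorphic to the $q$-clique extension of the collinearity graph of some classical polar space of rank $n-1$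 over $\mathbb F_q$, and the latter graph is a primitive strongly regular graph; 2. no local graph of $\Gamma$ is strongly regular; 3. for every primitive strongly regular graph $\Delta$ and every integer $m\ge 2$, the $m$-clique extension of $\Delta$ is not strongly regular. -/

import Mathlib

universe u v w

section GraphNotions

variable {V : Type*}

open Classical in
/-- A finite graph is strongly regular if it is so for some parameters. Complete graphs and
edgeless graphs are allowed. -/
def IsStronglyRegular [Finite V] (G : SimpleGraph V) : Prop :=
  letI : Fintype V := Fintype.ofFinite V
  ∃ n k l m : ℕ, G.IsSRGWith n k l m

/-- A primitive strongly regular graph: it and its complement are connected (and it has more than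
one vertex; the one-vertex graph is not a two-class association scheme). -/
def IsPrimitiveSRG [Finite V] (G : SimpleGraph V) : Prop :=
  IsStronglyRegular G ∧ Nontrivial V ∧ G.Connected ∧ Gᶜ.Connected

/-- The `m`-clique extension of a graph: every vertex is replaced by a clique of size `m`. -/
def cliqueExtension (m : ℕ) (G : SimpleGraph V) : SimpleGraph (Fin m × V) where
  Adj a b := G.Adj a.2 b.2 ∨ (a.2 = b.2 ∧ a.1 ≠ b.1)
  symm := ⟨fun _ _ h => h.elim (fun h => Or.inl h.symm) (fun h => Or.inr ⟨h.1.symm, h.2.symm⟩)⟩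
  loopless := ⟨fun a h => h.elim (fun h => G.loopless.irrefl a.2 h) (fun h => h.2 rfl)⟩

/-- The subgraph induced on the neighbours of `x` (the first subconstituent at `x`). -/
abbrev localGraph (G : SimpleGraph V) (x : V) : SimpleGraph (G.neighborSet x) :=
  G.induce (G.neighborSet x)

/-- The relations `R₀`, `R₁`, `R₂` of the scheme of a graph: equality, adjacency, and
non-adjacency of distinct vertices. -/
def schemeRel (G : SimpleGraph V) : Fin 3 → V → V → Prop :=
  ![fun x y => x = y, G.Adj, Gᶜ.Adj]

open Classical in
/-- The adjacency matrix `A_j` of the relation `R_j`. -/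
noncomputable def schemeMatrix (G : SimpleGraph V) (j : Fin 3) : Matrix V V ℂ :=
  Matrix.of fun x y => if schemeRel G j x y then 1 else 0

open Classical in
/-- The diagonal idempotent `E*_{i,ω}`. -/
noncomputable def dualIdempotent (G : SimpleGraph V) (ω : V) (i : Fin 3) : Matrix V V ℂ :=
  Matrix.diagonal fun x => if schemeRel G i ω x then 1 else 0

/-- The space `T_{0,ω}` spanned by the products `E*_i A_j E*_k`. -/
noncomputable def tripleSpan [Fintype V] (G : SimpleGraph V) (ω : V) :
    Submodule ℂ (Matrix V V ℂ) :=
  Submodule.span ℂ {M | ∃ i j k : Fin 3,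
    M = dualIdempotent G ω i * schemeMatrix G j * dualIdempotent G ω k}

open Classical in
/-- The Terwilliger algebra `T_ω`, generated by all `A_j` and all `E*_{i,ω}`. -/
noncomputable def terwilligerAlgebra [Fintype V] (G : SimpleGraph V) (ω : V) :
    Subalgebra ℂ (Matrix V V ℂ) :=
  Algebra.adjoin ℂ (Set.range (schemeMatrix G) ∪ Set.range (dualIdempotent G ω))

open Classical in
/-- The centralizer algebra of the stabilizer of `ω` in the automorphism group: all matrices that
commute with the permutation matrices of the automorphisms fixing `ω`. -/
noncomputable def stabilizerCentralizer [Fintype V] (G : SimpleGraph V) (ω : V) :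
    Subalgebra ℂ (Matrix V V ℂ) :=
  Subalgebra.centralizer ℂ
    {P | ∃ g : G ≃g G, g ω = ω ∧ P = Equiv.Perm.permMatrix ℂ g.toEquiv}

open Classical in
/-- Triple transitivity: the automorphism group is transitive on the vertices, and the three spaces
`T_{0,ω}`, `T_ω` and the centralizer algebra of the stabilizer of `ω` coincide. -/
def IsTriplyTransitive [Finite V] (G : SimpleGraph V) : Prop :=
  letI : Fintype V := Fintype.ofFinite V
  (∀ x y : V, ∃ g : G ≃g G, g x = y) ∧
    ∀ ω : V, tripleSpan G ω = Subalgebra.toSubmodule (terwilligerAlgebra G ω) ∧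
      terwilligerAlgebra G ω = stabilizerCentralizer G ω

end GraphNotions

/-- A classical polar space on the vector space `V` over `K`, given by the form that defines it: a
nondegenerate alternating form, a nondegenerate Hermitian form for a field automorphism of order
two, or a nonsingular quadratic form (no nonzero singular vector lies in the radical of the
polar form; in characteristic two the polar form itself may be degenerate). -/
inductive ClassicalPolarSpace (K V : Type*) [Field K] [AddCommGroup V] [Module K V] where
  | symplectic (B : V →ₗ[K] V →ₗ[K] K) (alt : B.IsAlt) (nondeg : B.Nondegenerate)
  | hermitian (σ : K →+* K) (order_two : (∀ a, σ (σ a) = a) ∧ ∃ a, σ a ≠ a)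
      (B : V →ₛₗ[σ] V →ₗ[K] K) (symm : B.IsSymm) (nondeg : B.Nondegenerate)
  | orthogonal (Q : QuadraticForm K V)
      (nonsing : ∀ x, Q x = 0 → (∀ y, QuadraticMap.polar Q x y = 0) → x = 0)

namespace ClassicalPolarSpace

variable {K V : Type*} [Field K] [AddCommGroup V] [Module K V]

/-- Totally isotropic subspaces (totally singular ones in the orthogonal case): the subspaces that
belong to the polar space. -/
def IsSingular : ClassicalPolarSpace K V → Submodule K V → Prop
  | symplectic B _ _, W => ∀ x ∈ W, ∀ y ∈ W, B x y = 0
  | hermitian _ _ B _ _, W => ∀ x ∈ W, ∀ y ∈ W, B x y = 0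
  | orthogonal Q _, W => ∀ x ∈ W, Q x = 0

/-- The rank: the largest vector space dimension of a totally singular subspace. -/
def HasRank (P : ClassicalPolarSpace K V) (n : ℕ) : Prop :=
  IsGreatest {d | ∃ W : Submodule K V, P.IsSingular W ∧ Module.finrank K W = d} n

/-- The points of the polar space: the one-dimensional totally singular subspaces. -/
abbrev Point (P : ClassicalPolarSpace K V) : Type _ :=
  {p : Projectivization K V // P.IsSingular p.submodule}

instance finite_point [Finite K] [FiniteDimensional K V] (P : ClassicalPolarSpace K V) :
    Finite P.Point :=
  haveI : Finite V := Module.finite_of_finite K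
  inferInstance

/-- Two distinct points are adjacent if the line joining them is totally singular. -/
def collinearityGraph (P : ClassicalPolarSpace K V) : SimpleGraph P.Point where
  Adj p r := p ≠ r ∧ P.IsSingular (p.1.submodule ⊔ r.1.submodule)
  symm := ⟨fun _ _ h => ⟨h.1.symm, by rw [sup_comm]; exact h.2⟩⟩
  loopless := ⟨fun _ h => h.1 rfl⟩

end ClassicalPolarSpace

/-!
Fix a hyperbolic pair `x, y` of singular vectors. The form restricted to `{x, y}ᗮ` defines a polar
space of rank one less, the residue of the pair. The points collinear with `⟨x⟩` are the points
`⟨u + a • x⟩` with `⟨u⟩` a point of the residue and `a` a scalar, so the local graph at `⟨x⟩` is the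
`q`-clique extension of the collinearity graph of the residue; the points collinear with both `⟨x⟩`
and `⟨y⟩` are those with `a = 0`.

Each point not collinear with `⟨x⟩` is spanned by a unique singular vector `z` with `form x z = 1`.
Decomposing these vectors along `x`, `y` and `{x, y}ᗮ` shows that their number depends only on `q`,
the dimension and the type of the form. Applied to the polar space and to its residues, this count
gives strong regularity.

Two copies of a vertex in a clique extension are adjacent twins. If all adjacent vertices of a
connected graph are twins then the graph is complete, so clique extensions of primitive strongly
regular graphs, and in particular the local graphs of a polar space, are not strongly regular.
Finally, if the span `T₀` equals the Terwilliger algebra, it contains `(E*₁ A₁ E*₁)²`. The entries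
of this matrix are the numbers of common neighbours in the local graph, and lying in `T₀` makes them
depend only on the relation between the two vertices, so that the local graph is strongly regular.
-/

section StronglyRegular

variable {V W : Type*} {G : SimpleGraph V} {H : SimpleGraph W}

theorem schemeRel_iff_eq {i : Fin 3} {x y : V} (h : schemeRel G i x y) (j : Fin 3) :
    schemeRel G j x y ↔ j = i := by
  have hne : G.Adj x y → x ≠ y := fun hxy => hxy.ne
  fin_cases i <;> fin_cases j <;> simp_all [schemeRel]

theorem schemeRel_iso_iff (e : G ≃g H) (j : Fin 3) {x y : V} :
    schemeRel H j (e x) (e y) ↔ schemeRel G j x y := by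
  fin_cases j <;> simp [schemeRel, e.injective.eq_iff, e.map_adj_iff]

theorem schemeRel_localGraph_iff {x : V} (j : Fin 3) {y z : G.neighborSet x} :
    schemeRel (localGraph G x) j y z ↔ schemeRel G j (y : V) z := by
  fin_cases j <;> simp [schemeRel, Subtype.ext_iff]

/-- The numbers `p j` are the intersection numbers `p^j_{1,1}`; in particular `p 0` is the valency,
since `x` and `x` have all neighbours of `x` in common. -/
theorem isStronglyRegular_iff_exists_ncard [Finite V] :
    IsStronglyRegular G ↔ ∃ p : Fin 3 → ℕ, ∀ j x y, schemeRel G j x y →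
      (G.commonNeighbors x y).ncard = p j := by
  classical
  let _ : Fintype V := Fintype.ofFinite V
  have card_eq (x y : V) : Fintype.card (G.commonNeighbors x y) = (G.commonNeighbors x y).ncard :=
    Fintype.card_eq_nat_card
  have degree_eq (x : V) : G.degree x = (G.commonNeighbors x x).ncard := by
    rw [← G.card_neighborSet_eq_degree, Fintype.card_eq_nat_card, Nat.card_coe_set_eq,
      SimpleGraph.commonNeighbors, Set.inter_self]
  constructor
  · rintro ⟨n, k, l, m, h⟩
    refine ⟨![k, l, m], Fin.forall_fin_succ.2 ⟨?_, Fin.forall_fin_two.2 ⟨?_, ?_⟩⟩⟩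
    · rintro x _ rfl
      rw [← degree_eq]
      exact h.regular x
    · intro x y hxy
      rw [← card_eq]
      exact h.of_adj x y hxy
    · intro x y hxy
      rw [← card_eq]
      exact h.of_not_adj hxy.1 hxy.2
  · rintro ⟨p, hp⟩
    refine ⟨_, p 0, p 1, p 2, rfl, fun x => ?_, fun x y hxy => ?_, fun x y hne hxy => ?_⟩
    · rw [← hp 0 x x rfl, ← degree_eq]
    · rw [← hp 1 x y hxy, ← card_eq]
    · rw [← hp 2 x y ⟨hne, hxy⟩, ← card_eq]

theorem image_commonNeighbors_iso (e : G ≃g H) (x y : V) :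
    e '' G.commonNeighbors x y = H.commonNeighbors (e x) (e y) := by
  ext z
  obtain ⟨z, rfl⟩ := e.surjective z
  simp [SimpleGraph.mem_commonNeighbors, e.map_adj_iff]

theorem IsStronglyRegular.of_iso [Finite V] [Finite W] (e : G ≃g H) (h : IsStronglyRegular G) :
    IsStronglyRegular H := by
  rw [isStronglyRegular_iff_exists_ncard] at h ⊢
  obtain ⟨p, hp⟩ := h
  refine ⟨p, fun j x y hxy => ?_⟩
  obtain ⟨x, rfl⟩ := e.surjective x
  obtain ⟨y, rfl⟩ := e.surjective y
  rw [← image_commonNeighbors_iso, Set.ncard_image_of_injective _ e.injective]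
  exact hp j x y ((schemeRel_iso_iff e j).1 hxy)

theorem image_val_commonNeighbors_localGraph {x : V} (y z : G.neighborSet x) :
    Subtype.val '' (localGraph G x).commonNeighbors y z =
      {w | G.Adj x w ∧ G.Adj y w ∧ G.Adj z w} := by
  ext w
  simp [SimpleGraph.mem_commonNeighbors, and_comm (b := G.Adj x w)]

theorem ncard_neighborSet_localGraph (G : SimpleGraph V) {x : V} (y : G.neighborSet x) :
    ((localGraph G x).neighborSet y).ncard = (G.commonNeighbors x y).ncard := by
  rw [← Set.ncard_image_of_injective _ Subtype.val_injective]
  congr 1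
  ext z
  simp [SimpleGraph.mem_commonNeighbors, and_comm]

theorem ncard_neighborSet_add_ncard_compl_neighborSet [Finite V] (G : SimpleGraph V) (x : V) :
    (G.neighborSet x).ncard + (Gᶜ.neighborSet x).ncard + 1 = Nat.card V := by
  have h : insert x (Gᶜ.neighborSet x) = (G.neighborSet x)ᶜ := by
    ext y
    by_cases hy : y = x
    · simp [hy]
    · simp [hy, Ne.symm hy]
  rw [← Set.ncard_add_ncard_compl (G.neighborSet x), ← h,
    Set.ncard_insert_of_notMem (by simp), add_assoc]

theorem ncard_commonNeighbors_add_one_eq_iff [Finite V] {u v : V} (huv : G.Adj u v) :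
    (G.commonNeighbors u v).ncard + 1 = (G.neighborSet u).ncard ↔
      ∀ w, G.Adj u w → w ≠ v → G.Adj v w := by
  have hsub : G.commonNeighbors u v ⊆ G.neighborSet u \ {v} :=
    fun w hw => ⟨hw.1, fun hwv : w = v => hw.2.ne hwv.symm⟩
  rw [← Set.ncard_sdiff_singleton_add_one ((G.mem_neighborSet u v).2 huv), add_left_inj]
  constructor
  · intro hcard w huw hwv
    have heq := Set.eq_of_subset_of_ncard_le hsub hcard.ge
    exact (heq.ge ⟨huw, hwv⟩ : w ∈ G.commonNeighbors u v).2
  · exact fun h => congrArg Set.ncard (hsub.antisymm fun w hw => ⟨hw.1, h w hw.1 hw.2⟩)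

theorem IsStronglyRegular.adj_of_adj_twins [Finite V] (h : IsStronglyRegular G) {u v : V}
    (huv : G.Adj u v) (htwins : ∀ w, G.Adj u w → w ≠ v → G.Adj v w) {a b c : V} (hab : G.Adj a b)
    (hac : G.Adj a c) (hbc : b ≠ c) : G.Adj b c := by
  obtain ⟨p, hp⟩ := isStronglyRegular_iff_exists_ncard.1 h
  have valency (x : V) : (G.neighborSet x).ncard = p 0 := by
    rw [← hp 0 x x rfl, SimpleGraph.commonNeighbors, Set.inter_self]
  have twins_iff {x y : V} (hxy : G.Adj x y) :
      p 1 + 1 = p 0 ↔ ∀ w, G.Adj x w → w ≠ y → G.Adj y w := by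
    rw [← hp 1 x y hxy, ← valency x, ncard_commonNeighbors_add_one_eq_iff hxy]
  exact (twins_iff hab).1 ((twins_iff huv).2 htwins) c hac hbc.symm

theorem eq_top_of_preconnected_of_adj_trans (hG : G.Preconnected)
    (htrans : ∀ {a b c}, G.Adj a b → G.Adj a c → b ≠ c → G.Adj b c) : G = ⊤ := by
  have adj_of_walk {x y : V} (w : G.Walk x y) (hxy : x ≠ y) : G.Adj x y := by
    induction w with
    | nil => exact absurd rfl hxy
    | @cons x z y hxz _ ih =>
      rcases eq_or_ne z y with rfl | hzy
      · exact hxz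
      · exact htrans hxz.symm (ih hzy) hxy
  ext x y
  exact ⟨fun h => h.ne, fun hxy => (hG x y).elim fun w => adj_of_walk w hxy⟩

theorem compl_neighborSet_cliqueExtension (m : ℕ) (G : SimpleGraph V) (a : Fin m × V) :
    (cliqueExtension m G)ᶜ.neighborSet a = Set.univ ×ˢ Gᶜ.neighborSet a.2 := by
  obtain ⟨i, x⟩ := a
  ext ⟨j, y⟩
  have hne : G.Adj x y → x ≠ y := fun h => h.ne
  simp only [cliqueExtension, SimpleGraph.mem_neighborSet, SimpleGraph.compl_adj, ne_eq,
    Prod.mk.injEq, not_or, not_and, not_not, Set.mem_prod, Set.mem_univ, true_and]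
  tauto

theorem ncard_compl_neighborSet_cliqueExtension (m : ℕ) (G : SimpleGraph V) (a : Fin m × V) :
    ((cliqueExtension m G)ᶜ.neighborSet a).ncard = m * (Gᶜ.neighborSet a.2).ncard := by
  rw [compl_neighborSet_cliqueExtension, Set.ncard_prod, Set.ncard_univ, Nat.card_fin]

/-- Two copies of a vertex are adjacent twins, so strong regularity would make all adjacent vertices
twins. -/
theorem not_isStronglyRegular_cliqueExtension [Finite V] (hG : IsPrimitiveSRG G) {m : ℕ}
    (hm : 2 ≤ m) : ¬ IsStronglyRegular (cliqueExtension m G) := by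
  intro h
  obtain ⟨-, hnontrivial, hconn, hcompl⟩ := hG
  let i : Fin m := ⟨0, by omega⟩
  let j : Fin m := ⟨1, by omega⟩
  have hij : i ≠ j := by simp [i, j]
  have copy_adj {x y : V} : (cliqueExtension m G).Adj (i, x) (i, y) ↔ G.Adj x y := by
    simp [cliqueExtension]
  have adj_trans {a b c : V} (hab : G.Adj a b) (hac : G.Adj a c) (hbc : b ≠ c) : G.Adj b c := by
    refine copy_adj.1 (h.adj_of_adj_twins (u := (i, a)) (v := (j, a)) (Or.inr ⟨rfl, hij⟩) ?_
      (copy_adj.2 hab) (copy_adj.2 hac) (by simpa using hbc))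
    rintro ⟨k, z⟩ (haz | ⟨rfl, -⟩) hne
    · exact Or.inl haz
    · exact Or.inr ⟨rfl, fun hjk : j = k => hne (by rw [hjk])⟩
  rw [eq_top_of_preconnected_of_adj_trans hconn.preconnected adj_trans, compl_top] at hcompl
  exact SimpleGraph.not_connected_bot hcompl

end StronglyRegular

section TerwilligerAlgebra

variable {V : Type*} [Fintype V] {G : SimpleGraph V} {ω : V}

open Classical in
theorem dualIdempotent_mul_schemeMatrix_mul_dualIdempotent_apply (i j k : Fin 3) (x y : V) :
    (dualIdempotent G ω i * schemeMatrix G j * dualIdempotent G ω k) x y =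
      if schemeRel G i ω x ∧ schemeRel G j x y ∧ schemeRel G k ω y then 1 else 0 := by
  simp only [dualIdempotent, schemeMatrix, Matrix.mul_diagonal, Matrix.diagonal_mul,
    Matrix.of_apply, mul_ite, mul_one, mul_zero, ite_and]
  split_ifs <;> rfl

theorem exists_apply_eq_of_mem_tripleSpan {M : Matrix V V ℂ} (hM : M ∈ tripleSpan G ω) :
    ∃ c : Fin 3 → Fin 3 → Fin 3 → ℂ, ∀ i j k x y, schemeRel G i ω x → schemeRel G j x y →
      schemeRel G k ω y → M x y = c i j k := by
  classical
  unfold tripleSpan at hM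
  induction hM using Submodule.span_induction with
  | mem M hM =>
    obtain ⟨i', j', k', rfl⟩ := hM
    refine ⟨fun i j k => if i' = i ∧ j' = j ∧ k' = k then 1 else 0, fun i j k x y hi hj hk => ?_⟩
    simp only [dualIdempotent_mul_schemeMatrix_mul_dualIdempotent_apply, schemeRel_iff_eq hi,
      schemeRel_iff_eq hj, schemeRel_iff_eq hk]
  | zero => exact ⟨0, fun _ _ _ _ _ _ _ _ => rfl⟩
  | add M N _ _ hM hN =>
    obtain ⟨c, hc⟩ := hM
    obtain ⟨d, hd⟩ := hN
    refine ⟨c + d, fun i j k x y hi hj hk => ?_⟩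
    rw [Matrix.add_apply, hc i j k x y hi hj hk, hd i j k x y hi hj hk]
    rfl
  | smul a M _ hM =>
    obtain ⟨c, hc⟩ := hM
    refine ⟨a • c, fun i j k x y hi hj hk => ?_⟩
    rw [Matrix.smul_apply, hc i j k x y hi hj hk]
    rfl

/-- The matrix `E*₁ A₁ E*₁`, that is, the adjacency matrix of the local graph at `ω` extended by
zero to all vertices. -/
noncomputable def localMatrix (G : SimpleGraph V) (ω : V) : Matrix V V ℂ :=
  dualIdempotent G ω 1 * schemeMatrix G 1 * dualIdempotent G ω 1

theorem localMatrix_mul_self_apply (x y : G.neighborSet ω) :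
    (localMatrix G ω * localMatrix G ω) x y =
      ((localGraph G ω).commonNeighbors x y).ncard := by
  classical
  have entry (u v : V) :
      localMatrix G ω u v = if G.Adj ω u ∧ G.Adj u v ∧ G.Adj ω v then 1 else 0 :=
    dualIdempotent_mul_schemeMatrix_mul_dualIdempotent_apply 1 1 1 u v
  have hx : G.Adj ω x := x.2
  have hy : G.Adj ω y := y.2
  have entry_mul_entry (z : V) : localMatrix G ω x z * localMatrix G ω z y =
      if G.Adj ω z ∧ G.Adj x z ∧ G.Adj y z then 1 else 0 := by
    simp only [entry, hx, hy, G.adj_comm z y, true_and, and_true, ite_zero_mul_ite_zero, mul_one]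
    congr 1
    grind
  rw [← Set.ncard_image_of_injective _ Subtype.val_injective, image_val_commonNeighbors_localGraph,
    Set.ncard_eq_toFinset_card', Matrix.mul_apply,
    Finset.sum_congr rfl fun z _ => entry_mul_entry z, Finset.sum_boole, Set.toFinset_ofPred]

open Classical in
theorem isStronglyRegular_localGraph_of_tripleSpan_eq
    (h : tripleSpan G ω = Subalgebra.toSubmodule (terwilligerAlgebra G ω)) :
    IsStronglyRegular (localGraph G ω) := by
  have mul_self_mem : localMatrix G ω * localMatrix G ω ∈ tripleSpan G ω := by
    have hmem : localMatrix G ω ∈ tripleSpan G ω := Submodule.subset_span ⟨1, 1, 1, rfl⟩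
    rw [h] at hmem ⊢
    exact (terwilligerAlgebra G ω).mul_mem hmem hmem
  obtain ⟨c, hc⟩ := exists_apply_eq_of_mem_tripleSpan mul_self_mem
  refine isStronglyRegular_iff_exists_ncard.2 ⟨fun j => ⌊(c 1 j 1).re⌋₊, fun j x y hxy => ?_⟩
  have hentry := hc 1 j 1 x y x.2 ((schemeRel_localGraph_iff j).1 hxy) y.2
  rw [localMatrix_mul_self_apply] at hentry
  simp only [← hentry, Complex.natCast_re, Nat.floor_natCast]

end TerwilligerAlgebra

theorem exists_add_eq_of_involutive {K : Type*} [Field K] {σ : K →+* K}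
    (hσ : Function.Involutive σ) (hσ_ne : ∃ a, σ a ≠ a) {c : K} (hc : σ c = c) :
    ∃ a, a + σ a = c := by
  obtain ⟨b, hb⟩ : ∃ b, b + σ b ≠ 0 := by
    by_contra! htrace
    obtain ⟨a, ha⟩ := hσ_ne
    have h1 := htrace 1
    rw [map_one] at h1
    exact ha (by linear_combination htrace a - a * h1)
  have hb_fixed : σ (b + σ b) = b + σ b := by rw [map_add, hσ b, add_comm]
  refine ⟨c * (b + σ b)⁻¹ * b, ?_⟩
  rw [map_mul, map_mul, map_inv₀, hc, hb_fixed, ← mul_add, inv_mul_cancel_right₀ hb]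

theorem finrank_le_finrank_inf_ker_add_one {K V : Type*} [Field K] [AddCommGroup V]
    [Module K V] (W : Submodule K V) [FiniteDimensional K W] (f : V →ₗ[K] K) :
    Module.finrank K W ≤ Module.finrank K (W ⊓ f.ker : Submodule K V) + 1 := by
  have hrange : Module.finrank K (f.domRestrict W).range ≤ 1 :=
    (Submodule.finrank_le _).trans (Module.finrank_self K).le
  have hker : (f.domRestrict W).ker.map W.subtype = W ⊓ f.ker := by
    rw [LinearMap.ker_domRestrict, Submodule.map_comap_subtype]
  have hsum := (f.domRestrict W).finrank_range_add_finrank_ker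
  rw [← Submodule.finrank_map_subtype_eq W (f.domRestrict W).ker, hker] at hsum
  lia

namespace ClassicalPolarSpace

variable {K V : Type*} [Field K] [AddCommGroup V] [Module K V] {P : ClassicalPolarSpace K V}
  {x y z : V}

/-- The field endomorphism with respect to which the form of a polar space is semilinear in its
first argument; it allows the three types to be treated at once. -/
def conj : ClassicalPolarSpace K V → K →+* K
  | symplectic _ _ _ => RingHom.id K
  | hermitian σ _ _ _ _ => σ
  | orthogonal _ _ => RingHom.id K

/-- The reflexive sesquilinear form of a polar space: the defining form, or the polar form of the
quadratic form in the orthogonal case. -/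
def form : (P : ClassicalPolarSpace K V) → V →ₛₗ[P.conj] V →ₗ[K] K
  | symplectic B _ _ => B
  | hermitian _ _ B _ _ => B
  | orthogonal Q _ => Q.polarBilin

/-- The function on vectors whose zeros are the singular vectors: `0` in the symplectic case (all
vectors are singular), `x ↦ B x x` in the Hermitian case, the quadratic form in the orthogonal
case. -/
def quad : ClassicalPolarSpace K V → V → K
  | symplectic _ _ _ => 0
  | hermitian _ _ B _ _ => fun x => B x x
  | orthogonal Q _ => Q

/-- The additive map `t` with `quad (x + y) = quad x + quad y + t (form x y)`. -/
def tr : ClassicalPolarSpace K V → K →+ K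
  | symplectic _ _ _ => 0
  | hermitian σ _ _ _ _ => AddMonoidHom.id K + σ
  | orthogonal _ _ => AddMonoidHom.id K

@[simp]
theorem form_symplectic (B : V →ₗ[K] V →ₗ[K] K) (alt nondeg) (x y : V) :
    (symplectic B alt nondeg).form x y = B x y := rfl

@[simp]
theorem form_hermitian (σ : K →+* K) (hσ) (B : V →ₛₗ[σ] V →ₗ[K] K) (symm nondeg) (x y : V) :
    (hermitian σ hσ B symm nondeg).form x y = B x y := rfl

@[simp]
theorem form_orthogonal (Q : QuadraticForm K V) (nonsing) (x y : V) :
    (orthogonal Q nonsing).form x y = QuadraticMap.polar Q x y := rfl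

theorem form_isRefl (P : ClassicalPolarSpace K V) : P.form.IsRefl := by
  intro x y h
  cases P with
  | symplectic B alt _ => exact alt.isRefl x y h
  | hermitian σ _ B symm _ => exact symm.isRefl x y h
  | orthogonal Q _ => rwa [form_orthogonal, QuadraticMap.polar_comm]

theorem form_comm_eq_zero : P.form x y = 0 ↔ P.form y x = 0 :=
  ⟨P.form_isRefl x y, P.form_isRefl y x⟩

theorem quad_add (P : ClassicalPolarSpace K V) (x y : V) :
    P.quad (x + y) = P.quad x + P.quad y + P.tr (P.form x y) := by
  cases P with
  | symplectic B _ _ => simp [quad, tr]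
  | hermitian σ _ B symm _ =>
    simp only [quad, tr, form_hermitian, map_add, LinearMap.add_apply, AddMonoidHom.add_apply,
      AddMonoidHom.id_apply, AddMonoidHom.coe_coe, symm.eq]
    ring
  | orthogonal Q _ => simp [quad, tr, QuadraticMap.polar]

theorem quad_smul (hx : P.quad x = 0) (a : K) : P.quad (a • x) = 0 := by
  cases P with
  | symplectic B _ _ => rfl
  | hermitian σ _ B _ _ => simp_all [quad]
  | orthogonal Q _ => simp_all [quad, QuadraticMap.map_smul]

theorem form_self (hx : P.quad x = 0) : P.form x x = 0 := by
  cases P with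
  | symplectic B alt _ => exact alt x
  | hermitian σ _ B _ _ => exact hx
  | orthogonal Q _ => simp_all [quad]

theorem exists_tr_eq_neg_quad (P : ClassicalPolarSpace K V) (x : V) :
    ∃ a, P.tr a = -P.quad x := by
  cases P with
  | symplectic B _ _ => exact ⟨0, neg_zero.symm⟩
  | hermitian σ hσ B symm _ =>
    exact exists_add_eq_of_involutive hσ.1 hσ.2 (c := -B x x) (by rw [map_neg, symm.eq])
  | orthogonal Q _ => exact ⟨_, rfl⟩

theorem isSingular_iff {W : Submodule K V} :
    P.IsSingular W ↔ ∀ x ∈ W, P.quad x = 0 ∧ ∀ y ∈ W, P.form x y = 0 := by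
  cases P with
  | symplectic B _ _ => simp [IsSingular, quad]
  | hermitian σ _ B _ _ =>
    exact ⟨fun h x hx => ⟨h x hx x hx, h x hx⟩, fun h x hx => (h x hx).2⟩
  | orthogonal Q _ =>
    refine ⟨fun h x hx => ⟨h x hx, fun y hy => ?_⟩, fun h x hx => (h x hx).1⟩
    simp [QuadraticMap.polar, h x hx, h y hy, h _ (W.add_mem hx hy)]

theorem IsSingular.mono {W W' : Submodule K V} (hW' : P.IsSingular W') (h : W ≤ W') :
    P.IsSingular W := by
  rw [isSingular_iff] at hW' ⊢
  exact fun x hx => ⟨(hW' x (h hx)).1, fun y hy => (hW' x (h hx)).2 y (h hy)⟩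

theorem isSingular_span_singleton (hx : P.quad x = 0) : P.IsSingular (K ∙ x) := by
  simp only [isSingular_iff, Submodule.mem_span_singleton]
  rintro _ ⟨a, rfl⟩
  refine ⟨quad_smul hx a, ?_⟩
  rintro _ ⟨b, rfl⟩
  simp [form_self hx]

theorem IsSingular.sup_span_singleton {W : Submodule K V} (hW : P.IsSingular W)
    (hx : P.quad x = 0) (hxW : ∀ w ∈ W, P.form x w = 0) : P.IsSingular (W ⊔ K ∙ x) := by
  rw [isSingular_iff] at hW ⊢
  simp only [Submodule.mem_sup, Submodule.mem_span_singleton]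
  rintro _ ⟨w, hw, _, ⟨a, rfl⟩, rfl⟩
  have hwx : P.form w x = 0 := form_comm_eq_zero.1 (hxW w hw)
  refine ⟨by simp [quad_add, (hW w hw).1, quad_smul hx, hwx], ?_⟩
  rintro _ ⟨w', hw', _, ⟨b, rfl⟩, rfl⟩
  simp [(hW w hw).2 w' hw', hxW w' hw', form_self hx, hwx]

/-- No nonzero singular vector of `U` lies in the radical of the form restricted to `U`; this is
what makes the restriction of the polar space to `U` a polar space. -/
def IsNondegenerateOn (P : ClassicalPolarSpace K V) (U : Submodule K V) : Prop :=
  ∀ x ∈ U, P.quad x = 0 → (∀ y ∈ U, P.form x y = 0) → x = 0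

theorem isNondegenerateOn_top (P : ClassicalPolarSpace K V) : P.IsNondegenerateOn ⊤ := by
  intro x _ hx hxy
  cases P with
  | symplectic B _ nondeg => exact nondeg.1 x fun y => hxy y trivial
  | hermitian σ _ B _ nondeg => exact nondeg.1 x fun y => hxy y trivial
  | orthogonal Q nonsing => exact nonsing x hx fun y => hxy y trivial

/-- The polar space induced on a nondegenerate subspace by restricting the form. -/
def restrict : (P : ClassicalPolarSpace K V) → (U : Submodule K V) → P.IsNondegenerateOn U →
    ClassicalPolarSpace K U
  | symplectic B alt _, U, hU =>
    have hleft : (B.domRestrict₁₂ U U).SeparatingLeft := fun x hx =>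
      Subtype.ext (hU x x.2 rfl fun y hy => hx ⟨y, hy⟩)
    symplectic (B.domRestrict₁₂ U U) (fun x => alt x)
      ⟨hleft, fun x hx => hleft x fun y => alt.isRefl _ _ (hx y)⟩
  | hermitian σ hσ B symm _, U, hU =>
    have hleft : (B.domRestrict₁₂ U U).SeparatingLeft := fun x hx =>
      Subtype.ext (hU x x.2 (hx x) fun y hy => hx ⟨y, hy⟩)
    hermitian σ hσ (B.domRestrict₁₂ U U) (symm.domRestrict U)
      ⟨hleft, fun x hx => hleft x fun y => symm.isRefl _ _ (hx y)⟩
  | orthogonal Q _, U, hU =>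
    orthogonal (Q.restrict U) fun x hx hxy =>
      Subtype.ext (hU x x.2 hx fun y hy => hxy ⟨y, hy⟩)

section Restrict

variable {U : Submodule K V} (hU : P.IsNondegenerateOn U)

theorem quad_restrict (u : U) : (P.restrict U hU).quad u = P.quad u := by
  cases P <;> rfl

theorem form_restrict (u w : U) : (P.restrict U hU).form u w = P.form u w := by
  cases P <;> rfl

theorem tr_restrict : (P.restrict U hU).tr = P.tr := by
  cases P <;> rfl

theorem isSingular_restrict_iff {W : Submodule K U} :
    (P.restrict U hU).IsSingular W ↔ P.IsSingular (W.map U.subtype) := by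
  simp only [isSingular_iff, Submodule.mem_map, forall_exists_index, and_imp,
    forall_apply_eq_imp_iff₂, Submodule.subtype_apply, quad_restrict, form_restrict]

end Restrict

/-- A nonzero singular (isotropic) vector, that is, one spanning a point. -/
structure IsSingularVector (P : ClassicalPolarSpace K V) (x : V) : Prop where
  ne_zero : x ≠ 0
  quad_eq_zero : P.quad x = 0

/-- The point spanned by a singular vector. -/
def IsSingularVector.point (hx : P.IsSingularVector x) : P.Point :=
  ⟨Projectivization.mk K x hx.ne_zero, by
    rw [Projectivization.submodule_mk]
    exact isSingular_span_singleton hx.quad_eq_zero⟩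

theorem Point.isSingularVector_rep (p : P.Point) : P.IsSingularVector p.1.rep where
  ne_zero := p.1.rep_nonzero
  quad_eq_zero := by
    have hp := p.2
    rw [Projectivization.submodule_eq, isSingular_iff] at hp
    exact (hp _ (Submodule.mem_span_singleton_self _)).1

theorem Point.point_rep (p : P.Point) : p.isSingularVector_rep.point = p :=
  Subtype.ext p.1.mk_rep

theorem Point.exists_point_eq (p : P.Point) : ∃ x, ∃ hx : P.IsSingularVector x, hx.point = p :=
  ⟨_, _, p.point_rep⟩

theorem point_eq_point_iff (hx : P.IsSingularVector x) (hy : P.IsSingularVector y) :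
    hx.point = hy.point ↔ ∃ a : K, a • y = x := by
  rw [Subtype.ext_iff]
  exact Projectivization.mk_eq_mk_iff' K x y hx.ne_zero hy.ne_zero

theorem adj_point_iff (hx : P.IsSingularVector x) (hy : P.IsSingularVector y) :
    P.collinearityGraph.Adj hx.point hy.point ↔ hx.point ≠ hy.point ∧ P.form x y = 0 := by
  refine and_congr_right fun _ => ?_
  simp only [IsSingularVector.point, Projectivization.submodule_mk]
  constructor
  · intro h
    exact (isSingular_iff.1 h x (Submodule.mem_sup_left (Submodule.mem_span_singleton_self _))).2 y
      (Submodule.mem_sup_right (Submodule.mem_span_singleton_self _))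
  · intro hxy
    refine (isSingular_span_singleton hx.quad_eq_zero).sup_span_singleton hy.quad_eq_zero ?_
    simp only [Submodule.mem_span_singleton]
    rintro _ ⟨a, rfl⟩
    rw [map_smul, form_comm_eq_zero.1 hxy, smul_zero]

theorem compl_adj_point_iff (hx : P.IsSingularVector x) (hy : P.IsSingularVector y) :
    P.collinearityGraphᶜ.Adj hx.point hy.point ↔ P.form x y ≠ 0 := by
  have form_eq_zero_of_eq : hx.point = hy.point → P.form x y = 0 := by
    rw [point_eq_point_iff]
    rintro ⟨a, rfl⟩
    simp [form_self hy.quad_eq_zero]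
  rw [SimpleGraph.compl_adj, adj_point_iff]
  tauto

/-- A hyperbolic pair: two singular vectors on which the form takes the value `1`. -/
structure IsHyperbolicPair (P : ClassicalPolarSpace K V) (x y : V) : Prop where
  left : P.IsSingularVector x
  right : P.IsSingularVector y
  form_eq_one : P.form x y = 1

theorem isHyperbolicPair_of_form_eq_one (hx : P.quad x = 0) (hy : P.quad y = 0)
    (hxy : P.form x y = 1) : P.IsHyperbolicPair x y where
  left := ⟨by rintro rfl; simp at hxy, hx⟩
  right := ⟨by rintro rfl; simp at hxy, hy⟩
  form_eq_one := hxy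

theorem quad_add_smul (hx : P.quad x = 0) (hyx : P.form y x = 0) (a : K) :
    P.quad (y + a • x) = P.quad y := by
  rw [quad_add, quad_smul hx, map_smul, hyx, smul_zero, map_zero, add_zero, add_zero]

theorem IsSingularVector.exists_isHyperbolicPair (hx : P.IsSingularVector x) :
    ∃ y, P.IsHyperbolicPair x y := by
  obtain ⟨z, hz⟩ : ∃ z, P.form x z = 1 := by
    have hx_not_radical : ¬ ∀ z, P.form x z = 0 := fun h =>
      hx.ne_zero (P.isNondegenerateOn_top x trivial hx.quad_eq_zero fun z _ => h z)
    obtain ⟨z, hz⟩ := not_forall.1 hx_not_radical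
    exact ⟨(P.form x z)⁻¹ • z, by simp [hz]⟩
  have hzx : P.form z x ≠ 0 := fun h => one_ne_zero (hz.symm.trans (form_comm_eq_zero.1 h))
  obtain ⟨a, ha⟩ := P.exists_tr_eq_neg_quad z
  refine ⟨z + (a / P.form z x) • x, isHyperbolicPair_of_form_eq_one hx.quad_eq_zero ?_ ?_⟩
  · rw [quad_add, quad_smul hx.quad_eq_zero, map_smul, smul_eq_mul, div_mul_cancel₀ _ hzx, ha,
      add_zero, add_neg_cancel]
  · simp [hz, form_self hx.quad_eq_zero]

theorem Point.exists_isHyperbolicPair (p : P.Point) :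
    ∃ x y, ∃ h : P.IsHyperbolicPair x y, h.left.point = p := by
  obtain ⟨x, hx, rfl⟩ := p.exists_point_eq
  obtain ⟨y, h⟩ := hx.exists_isHyperbolicPair
  exact ⟨x, y, h, rfl⟩

theorem exists_isHyperbolicPair_of_compl_adj {p r : P.Point}
    (hpr : P.collinearityGraphᶜ.Adj p r) :
    ∃ x y, ∃ h : P.IsHyperbolicPair x y, h.left.point = p ∧ h.right.point = r := by
  obtain ⟨x, hx, rfl⟩ := p.exists_point_eq
  obtain ⟨y, hy, rfl⟩ := r.exists_point_eq
  rw [compl_adj_point_iff] at hpr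
  have h : P.IsHyperbolicPair x ((P.form x y)⁻¹ • y) :=
    isHyperbolicPair_of_form_eq_one hx.quad_eq_zero (quad_smul hy.quad_eq_zero _) (by simp [hpr])
  exact ⟨x, _, h, rfl, (point_eq_point_iff _ _).2 ⟨_, rfl⟩⟩

/-- The subspace `{x, y}ᗮ` of the vectors orthogonal to `x` and `y`. -/
def pairPerp (P : ClassicalPolarSpace K V) (x y : V) : Submodule K V :=
  (P.form x).ker ⊓ (P.form y).ker

theorem mem_pairPerp : z ∈ P.pairPerp x y ↔ P.form x z = 0 ∧ P.form y z = 0 := Iff.rfl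

/-- The component of `z` in `{x, y}ᗮ`, for a hyperbolic pair `x, y`. -/
def perpPart (P : ClassicalPolarSpace K V) (x y z : V) : V :=
  z - P.form x z • y - (P.form y z / P.form y x) • x

theorem add_smul_add_perpPart (hxz : P.form x z = 1) :
    y + (P.form y z / P.form y x) • x + P.perpPart x y z = z := by
  rw [perpPart, hxz]
  module

namespace IsHyperbolicPair

variable (h : P.IsHyperbolicPair x y)
include h

theorem form_right_left_ne_zero : P.form y x ≠ 0 := fun hyx =>
  one_ne_zero (h.form_eq_one.symm.trans (form_comm_eq_zero.1 hyx))

theorem perpPart_mem_pairPerp (z : V) : P.perpPart x y z ∈ P.pairPerp x y := by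
  simp [perpPart, mem_pairPerp, h.form_eq_one, form_self h.left.quad_eq_zero,
    form_self h.right.quad_eq_zero, h.form_right_left_ne_zero]

theorem isNondegenerateOn_pairPerp : P.IsNondegenerateOn (P.pairPerp x y) := by
  intro u hu hqu hperp
  refine P.isNondegenerateOn_top u trivial hqu fun z _ => ?_
  have hz := hperp _ (h.perpPart_mem_pairPerp z)
  obtain ⟨hxu, hyu⟩ := mem_pairPerp.1 hu
  simpa [perpPart, form_comm_eq_zero.1 hxu, form_comm_eq_zero.1 hyu] using hz

/-- The residue of a hyperbolic pair `x, y`: the polar space induced on `{x, y}ᗮ`. It is isomorphic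
to the polar space of the totally singular subspaces containing `x`. -/
def residue : ClassicalPolarSpace K (P.pairPerp x y) :=
  P.restrict (P.pairPerp x y) h.isNondegenerateOn_pairPerp

theorem quad_residue (u : P.pairPerp x y) : h.residue.quad u = P.quad u :=
  quad_restrict _ u

theorem form_residue (u w : P.pairPerp x y) : h.residue.form u w = P.form u w :=
  form_restrict _ u w

theorem tr_residue : h.residue.tr = P.tr :=
  tr_restrict _

theorem isSingular_residue_iff {W : Submodule K (P.pairPerp x y)} :
    h.residue.IsSingular W ↔ P.IsSingular (W.map (P.pairPerp x y).subtype) :=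
  isSingular_restrict_iff _

theorem finrank_pairPerp_add_two [FiniteDimensional K V] :
    Module.finrank K (P.pairPerp x y) + 2 = Module.finrank K V := by
  have hsurj : Function.Surjective ((P.form x).prod (P.form y)) := by
    rintro ⟨a, b⟩
    refine ⟨a • y + (b / P.form y x) • x, ?_⟩
    simp [h.form_eq_one, form_self h.left.quad_eq_zero, form_self h.right.quad_eq_zero,
      h.form_right_left_ne_zero]
  have hrank := ((P.form x).prod (P.form y)).finrank_range_add_finrank_ker
  rw [LinearMap.range_eq_top.2 hsurj, finrank_top, Module.finrank_prod, Module.finrank_self,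
    LinearMap.ker_prod] at hrank
  rw [← hrank, add_comm, pairPerp]

theorem quad_right_add_smul_add (a : K) {u : V} (hu : u ∈ P.pairPerp x y) :
    P.quad (y + (a / P.form y x) • x + u) = P.tr a + P.quad u := by
  obtain ⟨hxu, hyu⟩ := mem_pairPerp.1 hu
  have hform : P.form (y + (a / P.form y x) • x) u = 0 := by simp [hxu, hyu]
  rw [quad_add, hform, quad_add, h.right.quad_eq_zero, quad_smul h.left.quad_eq_zero, map_smul,
    smul_eq_mul, div_mul_cancel₀ _ h.form_right_left_ne_zero, map_zero]
  ring

/-- The singular vectors `z` with `form x z = 1` are the vectors `y + (a / form y x) • x + u`. -/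
def singularVectorsEquiv : {z : V // P.quad z = 0 ∧ P.form x z = 1} ≃
    {t : P.pairPerp x y × K // P.tr t.2 = -P.quad t.1} where
  toFun z := ⟨⟨⟨P.perpPart x y z, h.perpPart_mem_pairPerp z⟩, P.form y z⟩, by
    rw [eq_neg_iff_add_eq_zero, ← h.quad_right_add_smul_add _ (h.perpPart_mem_pairPerp z),
      add_smul_add_perpPart z.2.2, z.2.1]⟩
  invFun t := ⟨y + (t.1.2 / P.form y x) • x + t.1.1, by
    rw [h.quad_right_add_smul_add _ t.1.1.2, t.2, neg_add_cancel], by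
    simp [h.form_eq_one, form_self h.left.quad_eq_zero, (mem_pairPerp.1 t.1.1.2).1]⟩
  left_inv z := Subtype.ext (add_smul_add_perpPart z.2.2)
  right_inv := by
    rintro ⟨⟨⟨u, hu⟩, a⟩, ha⟩
    obtain ⟨hxu, hyu⟩ := mem_pairPerp.1 hu
    have hxx := form_self h.left.quad_eq_zero
    have hyy := form_self h.right.quad_eq_zero
    ext
    · simp [perpPart, hxu, hyu, hxx, hyy, h.form_eq_one, h.form_right_left_ne_zero]
      abel
    · simp [hyu, hyy, h.form_right_left_ne_zero]

theorem card_singularVectors :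
    Nat.card {z : V // P.quad z = 0 ∧ P.form x z = 1} =
      Nat.card (P.pairPerp x y) * Nat.card P.tr.ker := by
  have fiberEquiv (u : P.pairPerp x y) : Nonempty ({a // P.tr a = -P.quad u} ≃ P.tr.ker) := by
    obtain ⟨a, ha⟩ := P.exists_tr_eq_neg_quad u
    exact ha ▸ ⟨P.tr.fiberEquivKer a⟩
  rw [Nat.card_congr h.singularVectorsEquiv, ← Nat.card_prod]
  exact Nat.card_congr <|
    (Equiv.subtypeProdEquivSigmaSubtype fun (u : P.pairPerp x y) a => P.tr a = -P.quad u).trans <|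
      (Equiv.sigmaCongrRight fun u => (fiberEquiv u).some).trans (Equiv.sigmaEquivProd _ _)

end IsHyperbolicPair

/-- A point not collinear with `x` contains exactly one vector `z` with `form x z = 1`. -/
theorem IsSingularVector.ncard_compl_neighborSet_point (hx : P.IsSingularVector x) :
    (P.collinearityGraphᶜ.neighborSet hx.point).ncard =
      Nat.card {z : V // P.quad z = 0 ∧ P.form x z = 1} := by
  have isHyperbolicPair (z : {z : V // P.quad z = 0 ∧ P.form x z = 1}) : P.IsHyperbolicPair x z :=
    isHyperbolicPair_of_form_eq_one hx.quad_eq_zero z.2.1 z.2.2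
  have hinj : Function.Injective fun z => (isHyperbolicPair z).right.point := by
    intro z w hzw
    obtain ⟨a, ha⟩ := (point_eq_point_iff _ _).1 hzw
    have ha_one : a = 1 := by
      simpa [(isHyperbolicPair w).form_eq_one, (isHyperbolicPair z).form_eq_one] using
        congrArg (P.form x) ha
    exact Subtype.ext (by rw [← ha, ha_one, one_smul])
  rw [← Set.ncard_range_of_injective hinj]
  congr 1
  ext r
  constructor
  · intro hr
    obtain ⟨y, hy, rfl⟩ := r.exists_point_eq
    have hxy : P.form x y ≠ 0 := (compl_adj_point_iff hx hy).1 hr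
    exact ⟨⟨(P.form x y)⁻¹ • y, quad_smul hy.quad_eq_zero _, by simp [hxy]⟩,
      (point_eq_point_iff _ _).2 ⟨_, rfl⟩⟩
  · rintro ⟨z, rfl⟩
    rw [SimpleGraph.mem_neighborSet, compl_adj_point_iff, z.2.2]
    exact one_ne_zero

theorem ncard_compl_neighborSet [Finite K] [FiniteDimensional K V] (p : P.Point) :
    (P.collinearityGraphᶜ.neighborSet p).ncard =
      Nat.card K ^ (Module.finrank K V - 2) * Nat.card P.tr.ker := by
  obtain ⟨x, y, h, rfl⟩ := p.exists_isHyperbolicPair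
  rw [h.left.ncard_compl_neighborSet_point, h.card_singularVectors,
    Module.natCard_eq_pow_finrank (K := K), ← h.finrank_pairPerp_add_two, Nat.add_sub_cancel]

namespace IsHyperbolicPair

variable (h : P.IsHyperbolicPair x y)

theorem isSingularVector_add_smul {u : P.pairPerp x y} (hu : h.residue.IsSingularVector u)
    (a : K) : P.IsSingularVector ((u : V) + a • x) where
  ne_zero h0 := by
    have ha : a = 0 := by
      simpa [(mem_pairPerp.1 u.2).2, h.form_right_left_ne_zero] using congrArg (P.form y) h0
    exact hu.ne_zero (Subtype.ext (by simpa [ha] using h0))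
  quad_eq_zero := by
    rw [quad_add_smul h.left.quad_eq_zero (form_comm_eq_zero.1 (mem_pairPerp.1 u.2).1),
      ← h.quad_residue, hu.quad_eq_zero]

/-- The points `⟨u + a • x⟩` on the line joining the point `p = ⟨u⟩` of the residue to `⟨x⟩`, other
than `⟨x⟩` itself. The parameter `a` depends on the representative `u` chosen for `p`, except that
`a = 0` always gives `p`. -/
noncomputable def liftPoint (a : K) (p : h.residue.Point) : P.Point :=
  (h.isSingularVector_add_smul p.isSingularVector_rep a).point

theorem liftPoint_inj {a b : K} {p r : h.residue.Point} :
    h.liftPoint a p = h.liftPoint b r ↔ a = b ∧ p = r := by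
  refine ⟨fun heq => ?_, fun ⟨hab, hpr⟩ => by rw [hab, hpr]⟩
  obtain ⟨c, hc⟩ := (point_eq_point_iff _ _).1 heq
  have hcb : c * b = a := by
    simpa [(mem_pairPerp.1 (Subtype.property _)).2, h.form_right_left_ne_zero, ← mul_assoc] using
      congrArg (P.form y) hc
  have hrep : c • r.1.rep = p.1.rep := by
    rw [smul_add, smul_smul, hcb, add_left_inj] at hc
    exact Subtype.ext hc
  obtain rfl : p = r := by
    rw [← p.point_rep, ← r.point_rep]
    exact (point_eq_point_iff _ _).2 ⟨c, hrep⟩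
  have hc_one : c = 1 := smul_left_injective K p.1.rep_nonzero (by simpa using hrep)
  exact ⟨by rw [← hcb, hc_one, one_mul], rfl⟩

theorem adj_left_liftPoint (a : K) (p : h.residue.Point) :
    P.collinearityGraph.Adj h.left.point (h.liftPoint a p) := by
  refine (adj_point_iff _ _).2 ⟨fun heq => ?_, ?_⟩
  · obtain ⟨c, hc⟩ := (point_eq_point_iff _ _).1 heq.symm
    refine (h.isSingularVector_add_smul p.isSingularVector_rep (a - c)).ne_zero ?_
    rw [sub_smul, hc]
    abel
  · simp [(mem_pairPerp.1 (Subtype.property _)).1, form_self h.left.quad_eq_zero]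

theorem adj_right_liftPoint_iff {a : K} {p : h.residue.Point} :
    P.collinearityGraph.Adj h.right.point (h.liftPoint a p) ↔ a = 0 := by
  have hne : h.right.point ≠ h.liftPoint a p := by
    intro heq
    have hadj := h.adj_left_liftPoint a p
    rw [← heq, adj_point_iff, h.form_eq_one] at hadj
    exact one_ne_zero hadj.2
  refine (adj_point_iff _ _).trans ((and_iff_right hne).trans ?_)
  simp [(mem_pairPerp.1 (Subtype.property _)).2, h.form_right_left_ne_zero]

theorem exists_liftPoint_eq {r : P.Point} (hr : P.collinearityGraph.Adj h.left.point r) :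
    ∃ a p, h.liftPoint a p = r := by
  obtain ⟨z, hz, rfl⟩ := r.exists_point_eq
  obtain ⟨hne, hxz⟩ := (adj_point_iff _ _).1 hr
  let u : P.pairPerp x y := ⟨P.perpPart x y z, h.perpPart_mem_pairPerp z⟩
  obtain ⟨b, hub⟩ : ∃ b : K, (u : V) = z + b • x :=
    ⟨-(P.form y z / P.form y x), by simp [u, perpPart, hxz, sub_eq_add_neg]⟩
  have hu : h.residue.IsSingularVector u := by
    refine ⟨fun hu0 => hne ?_, ?_⟩
    · rw [eq_comm, point_eq_point_iff]
      refine ⟨-b, ?_⟩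
      rw [hu0] at hub
      rw [neg_smul, eq_comm]
      exact eq_neg_of_add_eq_zero_left hub.symm
    · rw [h.quad_residue, hub, quad_add_smul h.left.quad_eq_zero (form_comm_eq_zero.1 hxz),
        hz.quad_eq_zero]
  obtain ⟨c, hc⟩ := (point_eq_point_iff _ _).1 hu.point.point_rep
  refine ⟨-(c * b), hu.point, (point_eq_point_iff _ _).2 ⟨c, ?_⟩⟩
  rw [← hc, Submodule.coe_smul, hub]
  module

theorem adj_liftPoint_iff {a b : K} {p r : h.residue.Point} :
    P.collinearityGraph.Adj (h.liftPoint a p) (h.liftPoint b r) ↔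
      h.residue.collinearityGraph.Adj p r ∨ p = r ∧ a ≠ b := by
  have residue_adj : h.residue.collinearityGraph.Adj p r ↔
      p ≠ r ∧ P.form p.1.rep r.1.rep = 0 := by
    simpa only [Point.point_rep, form_residue] using
      adj_point_iff p.isSingularVector_rep r.isSingularVector_rep
  have form_self_rep : P.form p.1.rep p.1.rep = 0 :=
    form_self ((h.quad_residue _).symm.trans p.isSingularVector_rep.quad_eq_zero)
  have form_lift : P.form ((p.1.rep : V) + a • x) ((r.1.rep : V) + b • x) =
      P.form p.1.rep r.1.rep := by
    simp [(mem_pairPerp.1 (Subtype.property _)).1, form_self h.left.quad_eq_zero,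
      form_comm_eq_zero (y := x)]
  rw [residue_adj]
  have hadj := adj_point_iff (h.isSingularVector_add_smul p.isSingularVector_rep a)
    (h.isSingularVector_add_smul r.isSingularVector_rep b)
  rw [form_lift] at hadj
  refine hadj.trans ?_
  change h.liftPoint a p ≠ h.liftPoint b r ∧ _ ↔ _
  rw [ne_eq, h.liftPoint_inj]
  rcases eq_or_ne p r with rfl | hpr
  · simp [form_self_rep]
  · simp [hpr]

/-- The isomorphism of a clique extension of the collinearity graph of the residue with the local
graph: the copies of a point `p` are the points other than `⟨x⟩` on the line from `⟨x⟩` to `p`. -/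
noncomputable def cliqueExtensionIso [Finite K] :
    cliqueExtension (Nat.card K) h.residue.collinearityGraph ≃g
      localGraph P.collinearityGraph h.left.point where
  toEquiv := Equiv.ofBijective
    (fun t => ⟨h.liftPoint ((Finite.equivFin K).symm t.1) t.2, h.adj_left_liftPoint _ _⟩) <| by
      constructor
      · rintro ⟨i, p⟩ ⟨j, r⟩ heq
        obtain ⟨hij, hpr⟩ := h.liftPoint_inj.1 (congrArg Subtype.val heq)
        exact Prod.ext ((Finite.equivFin K).symm.injective hij) hpr
      · rintro ⟨r, hr⟩
        obtain ⟨a, p, rfl⟩ := h.exists_liftPoint_eq hr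
        exact ⟨(Finite.equivFin K a, p), by simp⟩
  map_rel_iff' := by
    intro s t
    exact h.adj_liftPoint_iff.trans
      (or_congr_right (and_congr_right' (Finite.equivFin K).symm.injective.ne_iff))

theorem commonNeighbors_left_right :
    P.collinearityGraph.commonNeighbors h.left.point h.right.point =
      Set.range (h.liftPoint 0) := by
  ext r
  constructor
  · rintro ⟨hleft, hright⟩
    obtain ⟨a, p, rfl⟩ := h.exists_liftPoint_eq hleft
    obtain rfl : a = 0 := h.adj_right_liftPoint_iff.1 hright
    exact ⟨p, rfl⟩
  · rintro ⟨p, rfl⟩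
    exact ⟨h.adj_left_liftPoint 0 p, h.adj_right_liftPoint_iff.2 rfl⟩

theorem ncard_commonNeighbors_left_right :
    (P.collinearityGraph.commonNeighbors h.left.point h.right.point).ncard =
      Nat.card h.residue.Point := by
  rw [h.commonNeighbors_left_right]
  exact Set.ncard_range_of_injective fun p r hpr => (h.liftPoint_inj.1 hpr).2

theorem ncard_neighborSet_left [Finite K] :
    (P.collinearityGraph.neighborSet h.left.point).ncard =
      Nat.card K * Nat.card h.residue.Point := by
  rw [← Nat.card_coe_set_eq, ← Nat.card_congr h.cliqueExtensionIso.toEquiv, Nat.card_prod,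
    Nat.card_fin]

end IsHyperbolicPair

theorem card_mul_ncard_commonNeighbors_of_compl_adj [Finite K] {p r : P.Point}
    (hpr : P.collinearityGraphᶜ.Adj p r) :
    Nat.card K * (P.collinearityGraph.commonNeighbors p r).ncard =
      (P.collinearityGraph.neighborSet p).ncard := by
  obtain ⟨x, y, h, rfl, rfl⟩ := exists_isHyperbolicPair_of_compl_adj hpr
  rw [h.ncard_commonNeighbors_left_right, h.ncard_neighborSet_left]

section StronglyRegular

variable [Finite K] [FiniteDimensional K V]

theorem ncard_neighborSet_add (p : P.Point) :
    (P.collinearityGraph.neighborSet p).ncard +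
      Nat.card K ^ (Module.finrank K V - 2) * Nat.card P.tr.ker + 1 = Nat.card P.Point := by
  rw [← ncard_compl_neighborSet p]
  exact ncard_neighborSet_add_ncard_compl_neighborSet _ p

/-- Count the neighbours and non-neighbours of `r` in the local graph at `p`. -/
theorem ncard_commonNeighbors_add_of_adj {p r : P.Point} (hpr : P.collinearityGraph.Adj p r) :
    (P.collinearityGraph.commonNeighbors p r).ncard +
      Nat.card K * (Nat.card K ^ (Module.finrank K V - 4) * Nat.card P.tr.ker) + 1 =
        (P.collinearityGraph.neighborSet p).ncard := by
  obtain ⟨x, y, h, rfl⟩ := p.exists_isHyperbolicPair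
  obtain ⟨t, ht⟩ := h.cliqueExtensionIso.surjective ⟨r, hpr⟩
  have finrank_residue : Module.finrank K (P.pairPerp x y) = Module.finrank K V - 2 :=
    Nat.eq_sub_of_add_eq h.finrank_pairPerp_add_two
  have valency : ((cliqueExtension (Nat.card K) h.residue.collinearityGraph).neighborSet t).ncard =
      (P.collinearityGraph.commonNeighbors h.left.point r).ncard := by
    rw [← Nat.card_coe_set_eq, Nat.card_congr (h.cliqueExtensionIso.mapNeighborSet t), ht,
      Nat.card_coe_set_eq, ncard_neighborSet_localGraph]
  have hcount := ncard_neighborSet_add_ncard_compl_neighborSet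
    (cliqueExtension (Nat.card K) h.residue.collinearityGraph) t
  rw [valency, ncard_compl_neighborSet_cliqueExtension, ncard_compl_neighborSet, h.tr_residue,
    finrank_residue, Nat.sub_sub, Nat.card_congr h.cliqueExtensionIso.toEquiv,
    Nat.card_coe_set_eq] at hcount
  exact hcount

theorem isStronglyRegular_collinearityGraph (P : ClassicalPolarSpace K V) :
    IsStronglyRegular P.collinearityGraph := by
  let k := Nat.card P.Point - (Nat.card K ^ (Module.finrank K V - 2) * Nat.card P.tr.ker + 1)
  have valency (p : P.Point) : (P.collinearityGraph.neighborSet p).ncard = k :=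
    Nat.eq_sub_of_add_eq ((add_assoc _ _ _).symm.trans (ncard_neighborSet_add p))
  refine isStronglyRegular_iff_exists_ncard.2
    ⟨![k, k - (Nat.card K * (Nat.card K ^ (Module.finrank K V - 4) * Nat.card P.tr.ker) + 1),
      k / Nat.card K], Fin.forall_fin_succ.2 ⟨?_, Fin.forall_fin_two.2 ⟨?_, ?_⟩⟩⟩
  · rintro p _ rfl
    rw [SimpleGraph.commonNeighbors, Set.inter_self]
    exact valency p
  · intro p r hpr
    exact Nat.eq_sub_of_add_eq ((add_assoc _ _ _).symm.trans
      ((ncard_commonNeighbors_add_of_adj hpr).trans (valency p)))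
  · intro p r hpr
    refine Nat.eq_div_of_mul_eq_right Nat.card_pos.ne' ?_
    rw [card_mul_ncard_commonNeighbors_of_compl_adj hpr, valency]

end StronglyRegular

section Rank

theorem IsSingular.exists_mem_of_finrank_le [FiniteDimensional K V] {W : Submodule K V}
    (hW : P.IsSingular W) (hx : P.quad x = 0) :
    ∃ X : Submodule K V, P.IsSingular X ∧ x ∈ X ∧ Module.finrank K W ≤ Module.finrank K X := by
  by_cases hxW : x ∈ W
  · exact ⟨W, hW, hxW, le_rfl⟩
  have hx_notMem : x ∉ W ⊓ (P.form x).ker := fun h => hxW h.1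
  refine ⟨W ⊓ (P.form x).ker ⊔ K ∙ x,
    (hW.mono inf_le_left).sup_span_singleton hx fun w hw => hw.2,
    Submodule.mem_sup_right (Submodule.mem_span_singleton_self x), ?_⟩
  rw [Submodule.finrank_sup_span_singleton hx_notMem]
  exact finrank_le_finrank_inf_ker_add_one W _

variable {n : ℕ}

theorem IsHyperbolicPair.hasRank_residue [FiniteDimensional K V] (h : P.IsHyperbolicPair x y)
    (hP : P.HasRank n) : h.residue.HasRank (n - 1) := by
  obtain ⟨⟨W, hW, rfl⟩, hmax⟩ := hP
  have finrank_add_one_le {U : Submodule K (P.pairPerp x y)} (hU : h.residue.IsSingular U) :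
      Module.finrank K U + 1 ≤ Module.finrank K W := by
    have hx_notMem : x ∉ U.map (P.pairPerp x y).subtype := by
      rintro ⟨u, -, hux⟩
      exact h.form_right_left_ne_zero (hux ▸ (mem_pairPerp.1 u.2).2)
    rw [← Submodule.finrank_map_subtype_eq, ← Submodule.finrank_sup_span_singleton hx_notMem]
    refine hmax ⟨_, (h.isSingular_residue_iff.1 hU).sup_span_singleton h.left.quad_eq_zero ?_, rfl⟩
    rintro _ ⟨u, -, rfl⟩
    exact (mem_pairPerp.1 u.2).1
  obtain ⟨X, hX, hxX, hWX⟩ := hW.exists_mem_of_finrank_le h.left.quad_eq_zero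
  have hX_le : X ⊓ (P.form y).ker ≤ P.pairPerp x y := fun v hv =>
    ⟨((isSingular_iff.1 hX) x hxX).2 v hv.1, hv.2⟩
  let U := (X ⊓ (P.form y).ker).comap (P.pairPerp x y).subtype
  have hU_map : U.map (P.pairPerp x y).subtype = X ⊓ (P.form y).ker := by
    rw [Submodule.map_comap_subtype, inf_eq_right.2 hX_le]
  have hU : h.residue.IsSingular U := by
    rw [h.isSingular_residue_iff, hU_map]
    exact hX.mono inf_le_left
  have finrank_le : Module.finrank K W ≤ Module.finrank K U + 1 := by
    rw [← Submodule.finrank_map_subtype_eq, hU_map]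
    exact hWX.trans (finrank_le_finrank_inf_ker_add_one X _)
  refine ⟨⟨U, hU, Nat.eq_sub_of_add_eq ((finrank_add_one_le hU).antisymm finrank_le)⟩, ?_⟩
  rintro _ ⟨U', hU', rfl⟩
  exact Nat.le_sub_of_add_le (finrank_add_one_le hU')

theorem HasRank.nonempty_point (hP : P.HasRank n) (hn : 1 ≤ n) : Nonempty P.Point := by
  obtain ⟨⟨W, hW, rfl⟩, -⟩ := hP
  have hW_ne : W ≠ ⊥ := by
    rintro rfl
    simp at hn
  obtain ⟨x, hxW, hx⟩ := W.exists_mem_ne_zero_of_ne_bot hW_ne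
  exact ⟨IsSingularVector.point ⟨hx, (isSingular_iff.1 hW x hxW).1⟩⟩

theorem HasRank.nontrivial_point (hP : P.HasRank n) (hn : 1 ≤ n) : Nontrivial P.Point := by
  obtain ⟨p⟩ := hP.nonempty_point hn
  obtain ⟨x, y, h, -⟩ := p.exists_isHyperbolicPair
  have hadj : P.collinearityGraphᶜ.Adj h.left.point h.right.point := by
    rw [compl_adj_point_iff, h.form_eq_one]
    exact one_ne_zero
  exact ⟨_, _, hadj.ne⟩

theorem HasRank.connected_collinearityGraph [FiniteDimensional K V] (hP : P.HasRank n)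
    (hn : 2 ≤ n) : P.collinearityGraph.Connected := by
  have : Nonempty P.Point := hP.nonempty_point (by lia)
  refine ⟨fun p r => ?_⟩
  by_cases hpr : P.collinearityGraphᶜ.Adj p r
  · obtain ⟨x, y, h, rfl, rfl⟩ := exists_isHyperbolicPair_of_compl_adj hpr
    obtain ⟨s⟩ := (h.hasRank_residue hP).nonempty_point (by lia)
    have hright := h.adj_right_liftPoint_iff (p := s).2 rfl
    exact (h.adj_left_liftPoint 0 s).reachable.trans hright.symm.reachable
  · rcases eq_or_ne p r with rfl | hne
    · rfl
    · exact (not_not.1 fun hadj => hpr ⟨hne, hadj⟩ : P.collinearityGraph.Adj p r).reachable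

/-- If the partner `y` of `x` is orthogonal to `z`, correct it by a partner of `z` in the residue
of `x, y`. -/
theorem IsSingularVector.exists_form_ne_zero_of_orthogonal (hx : P.IsSingularVector x)
    (hz : P.IsSingularVector z) (hxz : P.form x z = 0) :
    ∃ w, P.IsSingularVector w ∧ P.form x w ≠ 0 ∧ P.form z w ≠ 0 := by
  obtain ⟨y, h⟩ := hx.exists_isHyperbolicPair
  by_cases hzy : P.form z y = 0
  · let u : P.pairPerp x y := ⟨z, hxz, form_comm_eq_zero.1 hzy⟩
    have hu : h.residue.IsSingularVector u :=
      ⟨fun hu0 => hz.ne_zero (congrArg Subtype.val hu0), (h.quad_residue u).trans hz.quad_eq_zero⟩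
    obtain ⟨w, huw⟩ := hu.exists_isHyperbolicPair
    obtain ⟨hxw, hyw⟩ := mem_pairPerp.1 w.2
    have hzw : P.form z w = 1 := (h.form_residue u w).symm.trans huw.form_eq_one
    have hxyw : P.form x (y + w) = 1 := by rw [map_add, h.form_eq_one, hxw, add_zero]
    have hquad : P.quad (y + w) = 0 := by
      rw [quad_add, h.right.quad_eq_zero, ← h.quad_residue, huw.right.quad_eq_zero, hyw]
      simp
    refine ⟨y + w, (isHyperbolicPair_of_form_eq_one hx.quad_eq_zero hquad hxyw).right, ?_, ?_⟩
    · simp [hxyw]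
    · simp [hzy, hzw]
  · exact ⟨y, h.right, by simp [h.form_eq_one], hzy⟩

theorem HasRank.connected_compl_collinearityGraph (hP : P.HasRank n) (hn : 1 ≤ n) :
    P.collinearityGraphᶜ.Connected := by
  have : Nonempty P.Point := hP.nonempty_point hn
  refine ⟨fun p r => ?_⟩
  obtain ⟨x, hx, rfl⟩ := p.exists_point_eq
  obtain ⟨z, hz, rfl⟩ := r.exists_point_eq
  by_cases hxz : P.form x z = 0
  · obtain ⟨w, hw, hxw, hzw⟩ := hx.exists_form_ne_zero_of_orthogonal hz hxz
    exact ((compl_adj_point_iff hx hw).2 hxw).reachable.trans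
      ((compl_adj_point_iff hz hw).2 hzw).symm.reachable
  · exact ((compl_adj_point_iff hx hz).2 hxz).reachable

variable [Finite K] [FiniteDimensional K V]

theorem HasRank.isPrimitiveSRG_collinearityGraph (hP : P.HasRank n) (hn : 2 ≤ n) :
    IsPrimitiveSRG P.collinearityGraph :=
  ⟨P.isStronglyRegular_collinearityGraph, hP.nontrivial_point (by lia),
    hP.connected_collinearityGraph hn, hP.connected_compl_collinearityGraph (by lia)⟩

theorem HasRank.not_isStronglyRegular_localGraph (hP : P.HasRank n) (hn : 3 ≤ n) (p : P.Point) :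
    ¬ IsStronglyRegular (localGraph P.collinearityGraph p) := by
  obtain ⟨x, y, h, rfl⟩ := p.exists_isHyperbolicPair
  have hprim : IsPrimitiveSRG h.residue.collinearityGraph :=
    (h.hasRank_residue hP).isPrimitiveSRG_collinearityGraph (by lia)
  exact fun hlocal => not_isStronglyRegular_cliqueExtension hprim Finite.one_lt_card
    (hlocal.of_iso h.cliqueExtensionIso.symm)

theorem HasRank.not_isTriplyTransitive_collinearityGraph (hP : P.HasRank n) (hn : 3 ≤ n) :
    ¬ IsTriplyTransitive P.collinearityGraph := by
  obtain ⟨p⟩ := hP.nonempty_point (by lia)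
  let _ : Fintype P.Point := Fintype.ofFinite P.Point
  exact fun h => hP.not_isStronglyRegular_localGraph hn p
    (isStronglyRegular_localGraph_of_tripleSpan_eq (h.2 p).1)

end Rank

end ClassicalPolarSpace

theorem mainTheorem10 {K : Type u} {V : Type v} [Field K] [Finite K] [AddCommGroup V]
    [Module K V] [FiniteDimensional K V] (P : ClassicalPolarSpace K V) (n : ℕ) (hn : 3 ≤ n)
    (hP : P.HasRank n) :
    -- the collinearity graph is primitive strongly regular, and not triply transitive
    IsPrimitiveSRG P.collinearityGraph ∧
    ¬ IsTriplyTransitive P.collinearityGraph ∧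
    -- the local graph at every point is the `q`-clique extension of a primitive polar graph
    (∀ p : P.Point,
      ∃ (V' : Type v) (_ : AddCommGroup V') (_ : Module K V') (_ : FiniteDimensional K V')
        (P' : ClassicalPolarSpace K V'),
        P'.HasRank (n - 1) ∧ IsPrimitiveSRG P'.collinearityGraph ∧
        Nonempty (localGraph P.collinearityGraph p ≃g
          cliqueExtension (Nat.card K) P'.collinearityGraph)) ∧
    -- no local graph is strongly regular
    (∀ p : P.Point, ¬ IsStronglyRegular (localGraph P.collinearityGraph p)) ∧
    -- clique extensions of primitive strongly regular graphs are never strongly regular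
    (∀ (W : Type w) [Finite W] (G : SimpleGraph W), IsPrimitiveSRG G →
      ∀ m : ℕ, 2 ≤ m → ¬ IsStronglyRegular (cliqueExtension m G)) := by
  refine ⟨hP.isPrimitiveSRG_collinearityGraph (by lia),
    hP.not_isTriplyTransitive_collinearityGraph hn, fun p => ?_,
    hP.not_isStronglyRegular_localGraph hn,
    fun W _ G hG m hm => not_isStronglyRegular_cliqueExtension hG hm⟩
  obtain ⟨x, y, h, rfl⟩ := p.exists_isHyperbolicPair
  have hrank : h.residue.HasRank (n - 1) := h.hasRank_residue hP
  exact ⟨P.pairPerp x y, inferInstance, inferInstance, inferInstance, h.residue, hrank,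
    hrank.isPrimitiveSRG_collinearityGraph (by lia), ⟨h.cliqueExtensionIso.symm⟩⟩
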